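/- Let $M_1,M_2,N\ge 0$ be integers, $K=M_1+M_2$, and let $\alpha$, $\alpha_1,\dots,\alpha_N$ and $\eta_1,\dots,\eta_K\ge 0$ be real numbers. Put $\sigma_k=1$ for $k\le M_1$ and $\sigma_k=\alpha$ for $M_1<k\le K$. Consider the real Gaussian multiple access channel (MAC) with $K$ single-antenna users and an $N$-antenna receiver $$\mathbf Q=\sum_{k=1}^{K}\sqrt{P^{\sigma_k}}\,\mathbf H_kT_k+\sum_{m=1}^{N}\sqrt{P^{\alpha_m}}\,\mathbf G_mZ_m ,$$ where user $k$ sends $T_k\in\mathbb R$ under the average power constraint $P^{-\eta_k}$ (imposed on every codeword), the $Z_m$ are standard Gaussian, independent over $m$ and over channel uses, and the coefficient vectors $\mathbf H_k,\mathbf G_m\in\mathbb R^N$ have a joint law with a bounded density with respect to Lebesgue measure and are independent of the noise. The receiver knows the coefficients. Let $\mathcal C'(P)$ be the capacity region (the closure of the set of nonnegative rate tuples achievable by block codes with vanishing error probability, averaged over uniform independent messages). A tuple $(d'_1,\dots,d'_K)$ of generalized degrees of freedom (GDoF) is called achievable if there are $(R'_1(P),\dots,R'_K(P))\in\mathcal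 C'(P)$ for all $P>0$ with $d'_k=\lim_{P\to\infty}R'_k(P)/(\tfrac12\log P)$ for all $k$. Let $\gamma_k=(\sigma_k-\eta_k)^+$ be the received power level of user $k$, and assume that $\alpha_m\ge 0$ for all $m$ or that $\sigma_k\ge\eta_k$ for all $k$. Let $d'_1,\dots,d'_K\ge 0$ be real numbers such that for every $k\in\{1,\dots,K\}$ and every $S\subseteq\{1,\dots,K\}$ with $|S|=k$, $$\sum_{i\in S}d'_i\le\max_{S_2\subseteq S,\ |S_2|=\min(k,N)}\ \sum_{i\in S_2}\gamma_i-\min_{S_1\subseteq\{1,\dots,N\},\ |S_1|=\min(k,N)}\ \sum_{i\in S_1}\alpha_i .$$ Then $(d'_1,\dots,d'_K)$ is achievable, both (i) when the coefficients are drawn independently from their law in every channel use and the encoders do not know them, and (ii) for almost every realization of the coefficients, when they are drawn once and keep this value in all channel uses. -/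

import Mathlib

open MeasureTheory ProbabilityTheory Filter Topology

noncomputable section

namespace MAC

/-- Channel coefficients of one channel use: the receive directions `H₁, …, H_K ∈ ℝᴺ` of the `K`
users and the directions `G₁, …, G_N ∈ ℝᴺ` of the `N` noise terms. -/
abbrev Coeff (K N : ℕ) : Type := (Fin K → Fin N → ℝ) × (Fin N → Fin N → ℝ)

/-- A law on channel coefficients has a bounded density with respect to Lebesgue measure. -/
def HasBoundedDensity {K N : ℕ} (ν : Measure (Coeff K N)) : Prop :=
  ∃ (f : Coeff K N → ENNReal) (C : NNReal), Measurable f ∧ (∀ x, f x ≤ C) ∧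
    ν = volume.withDensity f

/-- The exponents of a real Gaussian multiple access channel with `K` single-antenna users and
`N` receive antennas: user `k` has channel gain `√(P ^ strength k)` and average transmit power at
most `P ^ (-powerExp k)`, and the `m`-th noise term has gain `√(P ^ noiseLevel m)`. -/
structure Exponents (K N : ℕ) where
  strength : Fin K → ℝ
  powerExp : Fin K → ℝ
  noiseLevel : Fin N → ℝ

/-- The received vector of one channel use,
`Q = ∑ₖ √(P ^ strength k) Hₖ Tₖ + ∑ₘ √(P ^ noiseLevel m) Gₘ Zₘ`. -/
def received {K N : ℕ} (E : Exponents K N) (P : ℝ) (h : Coeff K N) (T : Fin K → ℝ)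
    (Z : Fin N → ℝ) : Fin N → ℝ :=
  ∑ k, (Real.sqrt (P ^ E.strength k) * T k) • h.1 k +
    ∑ m, (Real.sqrt (P ^ E.noiseLevel m) * Z m) • h.2 m

/-- A block code of length `n` with `M k` messages for user `k`. The encoders do not see the
channel coefficients; the decoder knows those of all `n` channel uses. -/
structure Code (K N n : ℕ) (M : Fin K → ℕ) where
  enc : (k : Fin K) → Fin (M k) → Fin n → ℝ
  dec : (Fin n → Fin N → ℝ) × (Fin n → Coeff K N) → (k : Fin K) → Fin (M k)
  measurable_dec : Measurable dec

/-- Every codeword of user `k` has average power at most `P ^ (-powerExp k)`. -/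
def Code.PowerConstrained {K N n : ℕ} {M : Fin K → ℕ} (c : Code K N n M) (E : Exponents K N)
    (P : ℝ) : Prop :=
  ∀ k (w : Fin (M k)), ∑ t, (c.enc k w t) ^ 2 ≤ n * P ^ (-E.powerExp k)

/-- Joint law of the channel coefficients (i.i.d. over the `n` channel uses with law `ν`) and of
the noise variables (i.i.d. standard Gaussian, independent of the coefficients). -/
def blockLaw {K N : ℕ} (ν : Measure (Coeff K N)) (n : ℕ) :
    Measure ((Fin n → Coeff K N) × (Fin n → Fin N → ℝ)) :=
  (Measure.pi fun _ => ν).prod (Measure.pi fun _ => Measure.pi fun _ => gaussianReal 0 1)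

/-- The event that, when the message tuple `w` is sent, the decoder errs on at least one message. -/
def Code.errorEvent {K N n : ℕ} {M : Fin K → ℕ} (c : Code K N n M) (E : Exponents K N) (P : ℝ)
    (w : (k : Fin K) → Fin (M k)) : Set ((Fin n → Coeff K N) × (Fin n → Fin N → ℝ)) :=
  {x | c.dec (fun t => received E P (x.1 t) (fun k => c.enc k (w k) t) (x.2 t), x.1) ≠ w}

/-- Error probability, averaged over independent uniformly distributed messages. -/
def Code.avgError {K N n : ℕ} {M : Fin K → ℕ} (c : Code K N n M) (E : Exponents K N)
    (ν : Measure (Coeff K N)) (P : ℝ) : ℝ :=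
  (∑ w : (k : Fin K) → Fin (M k), (blockLaw ν n).real (c.errorEvent E P w)) / ∏ k, (M k : ℝ)

/-- Achievable rate tuples, in nats per channel use. -/
def Achievable {K N : ℕ} (E : Exponents K N) (ν : Measure (Coeff K N)) (P : ℝ)
    (R : Fin K → ℝ) : Prop :=
  (∀ k, 0 ≤ R k) ∧ ∀ ε : ℝ, 0 < ε → ∃ n₀ : ℕ, ∀ n ≥ n₀,
    ∃ (M : Fin K → ℕ) (c : Code K N n M), (∀ k, Real.exp (n * R k) ≤ M k) ∧
      c.PowerConstrained E P ∧ c.avgError E ν P ≤ ε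

/-- The capacity region at nominal signal-to-noise ratio `P`, for the memoryless channel whose
coefficients have law `ν` in every channel use. For a Dirac measure `ν` this is the channel whose
coefficients are fixed. -/
def capacityRegion {K N : ℕ} (E : Exponents K N) (ν : Measure (Coeff K N)) (P : ℝ) :
    Set (Fin K → ℝ) :=
  closure {R | Achievable E ν P R}

/-- The region of generalized degrees of freedom. -/
def gdofRegion {K N : ℕ} (E : Exponents K N) (ν : Measure (Coeff K N)) : Set (Fin K → ℝ) :=
  {d | ∃ R : ℝ → Fin K → ℝ, (∀ P > 0, R P ∈ capacityRegion E ν P) ∧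
    ∀ k, Tendsto (fun P => R P k / ((1 / 2) * Real.log P)) atTop (𝓝 (d k))}

/-- Strength exponents of the `M₁ + M₂` users: `1` for the first `M₁` users, `α` for the others. -/
def userStrength (M₁ M₂ : ℕ) (α : ℝ) (k : Fin (M₁ + M₂)) : ℝ :=
  if (k : ℕ) < M₁ then 1 else α

/-- The received power levels `γₖ`: `(1 - ηₖ)⁺` for the first `M₁` users, `(α - ηₖ)⁺` for the
others. -/
def gammaLevel (M₁ M₂ : ℕ) (α : ℝ) (η : Fin (M₁ + M₂) → ℝ) (k : Fin (M₁ + M₂)) : ℝ :=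
  max (userStrength M₁ M₂ α k - η k) 0

/-- The largest sum of `w` over subsets of `s` with exactly `j` elements. -/
def maxSubsetSum {ι : Type*} (s : Finset ι) (j : ℕ) (hj : j ≤ s.card) (w : ι → ℝ) : ℝ :=
  (s.powersetCard j).sup' (Finset.powersetCard_nonempty.2 hj) fun t => ∑ i ∈ t, w i

/-- The smallest sum of `w` over subsets of `s` with exactly `j` elements. -/
def minSubsetSum {ι : Type*} (s : Finset ι) (j : ℕ) (hj : j ≤ s.card) (w : ι → ℝ) : ℝ :=
  (s.powersetCard j).inf' (Finset.powersetCard_nonempty.2 hj) fun t => ∑ i ∈ t, w i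

end MAC

end

noncomputable section

namespace MAC

/-! Random coding, with codebook symbols uniform on `[0, 1]` and scaled to the power constraint. The
decoder multiplies the residual of a candidate message tuple by `adjugate G`, which decouples the
noise directions, and says that the candidate explains a slot if every coordinate is as small as
bounded noise allows. It outputs the unique tuple explaining all but a small fraction of the slots.

Let a wrong tuple differ from the true one exactly in the users of `S`, and let `D` be the sum of
`d` over `S`. The subset-sum bound for `S` yields `j` users of `S` and `j` noise directions whose
level difference is at least `D` (`exists_subsystem`). The fresh symbols of these users must fall in
the preimage of a box under an invertible matrix, so one slot is explained with probability at most
`C * P ^ (-D / 2)` (`slot_probability_le`). Codebook symbols are independent over slots, so about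
`n` slots give `P ^ (-n * D / 2)`, which beats the roughly `P ^ (n * s * D / 2)` such tuples when `s
< 1`.

The constant `C` needs minors bounded away from zero. They are nonzero almost everywhere, so for a
suitable constant `L` bad coefficients are so rare that they exceed a small fraction of the slots
with exponentially small probability; large noise is treated alike. Only almost sure general
position is used, so i.i.d. and frozen (Dirac) coefficients are covered together. -/

/-! ### Probability and volume estimates -/

/-- Union bound over the at most `2 ^ n` slot sets, with independence inside each. It serves both
for bad channel slots and for slots explained by a wrong tuple. -/
theorem pi_card_ge_le {n : ℕ} {X : Type*} [MeasurableSpace X] (μ : Measure X)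
    [IsProbabilityMeasure μ] (A : Fin n → Set X) (p : ENNReal) (hp : p ≤ 1)
    (hA : ∀ t, μ (A t) ≤ p) (m : ℕ) :
    Measure.pi (fun _ : Fin n => μ) {x | ∃ T : Finset (Fin n), m ≤ T.card ∧ ∀ t ∈ T, x t ∈ A t}
      ≤ 2 ^ n * p ^ m := by
  have hsub : {x : Fin n → X | ∃ T : Finset (Fin n), m ≤ T.card ∧ ∀ t ∈ T, x t ∈ A t} ⊆
      ⋃ T ∈ (Finset.univ.filter fun T : Finset (Fin n) => m ≤ T.card),
        (T : Set (Fin n)).pi A := by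
    rintro x ⟨T, hT, hx⟩
    simp only [Finset.mem_filter, Finset.mem_univ, true_and, Set.mem_iUnion]
    exact ⟨T, hT, fun t ht => hx t ht⟩
  refine (measure_mono hsub).trans ((measure_biUnion_finset_le _ _).trans ?_)
  calc ∑ T ∈ Finset.univ.filter (fun T : Finset (Fin n) => m ≤ T.card),
        Measure.pi (fun _ : Fin n => μ) ((T : Set (Fin n)).pi A)
      ≤ ∑ T ∈ Finset.univ.filter (fun T : Finset (Fin n) => m ≤ T.card), p ^ m := by
        refine Finset.sum_le_sum fun T hT => ?_
        rw [Measure.pi_pi_finset]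
        calc ∏ t ∈ T, μ (A t) ≤ ∏ _t ∈ T, p := Finset.prod_le_prod' fun t _ => hA t
          _ = p ^ T.card := by simp
          _ ≤ p ^ m := pow_le_pow_right_of_le_one' hp (Finset.mem_filter.1 hT).2
    _ ≤ ∑ T : Finset (Fin n), p ^ m :=
        Finset.sum_le_sum_of_subset (Finset.filter_subset _ _)
    _ = 2 ^ n * p ^ m := by simp

/-- The uniform distribution on the unit cube of `I → ℝ`. -/
def unitCube (I : Type*) [Fintype I] : Measure (I → ℝ) :=
  Measure.pi fun _ => volume.restrict (Set.Icc 0 1)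

instance : IsProbabilityMeasure (volume.restrict (Set.Icc (0 : ℝ) 1)) :=
  ⟨by simp⟩

instance (I : Type*) [Fintype I] : IsProbabilityMeasure (unitCube I) := by
  unfold unitCube; infer_instance

theorem unitCube_le_volume (I : Type*) [Fintype I] : unitCube I ≤ volume := by
  have h := Measure.restrict_pi_pi (fun _ : I => (volume : Measure ℝ)) (fun _ => Set.Icc 0 1)
  unfold unitCube
  rw [← h]
  exact Measure.restrict_le_self

/-- Fubini: freeze the coordinates outside the range of `ι`; on the remaining ones the uniform law
is dominated by Lebesgue measure. -/
theorem unitCube_le_of_extend {I : Type*} [Fintype I] {j : ℕ} (ι : Fin j → I)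
    (hι : Function.Injective ι) {E : Set (I → ℝ)} (hE : MeasurableSet E) (p : ENNReal)
    (h : ∀ v : I → ℝ, volume {u : Fin j → ℝ | Function.extend ι u v ∈ E} ≤ p) :
    unitCube I E ≤ p := by
  classical
  let q : I → Prop := fun i => i ∈ Set.range ι
  have mp := measurePreserving_piEquivPiSubtypeProd
    (fun _ : I => volume.restrict (Set.Icc (0 : ℝ) 1)) q
  have mp' := mp.symm
  have e1 : unitCube I E = ((unitCube (Subtype q)).prod (unitCube {i // ¬ q i}))
      ((MeasurableEquiv.piEquivPiSubtypeProd (fun _ : I => ℝ) q).symm ⁻¹' E) := by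
    unfold unitCube
    convert (mp'.measure_preimage hE.nullMeasurableSet).symm
    rfl
  rw [e1, Measure.prod_apply_symm (mp'.measurable hE)]
  calc _ ≤ ∫⁻ _ : {i // ¬ q i} → ℝ, p ∂(unitCube {i // ¬ q i}) := lintegral_mono fun y => ?_
    _ = p := by simp
  refine (unitCube_le_volume _ _).trans ?_
  let e : Fin j ≃ Subtype q := Equiv.ofInjective ι hι
  have mpe := volume_measurePreserving_piCongrLeft (fun _ : Subtype q => ℝ) e
  rw [← mpe.measure_preimage (measurable_prodMk_right (mp'.measurable hE)).nullMeasurableSet]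
  -- The value `0` on the range of `ι` is arbitrary: `Function.extend` overwrites it.
  refine le_of_eq_of_le ?_ (h fun i => if hi : q i then 0 else y ⟨i, hi⟩)
  congr 1
  ext u
  simp only [Set.mem_preimage, Set.mem_ofPred_eq]
  have : (MeasurableEquiv.piEquivPiSubtypeProd (fun _ : I => ℝ) q).symm
      ((MeasurableEquiv.piCongrLeft (fun _ : Subtype q => ℝ) e) u, y) =
      Function.extend ι u (fun i => if hi : q i then 0 else y ⟨i, hi⟩) := by
    funext i
    by_cases hi : q i
    · obtain ⟨a, rfl⟩ := hi
      rw [hι.extend_apply]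
      have : (⟨ι a, ⟨a, rfl⟩⟩ : Subtype q) = e a := rfl
      simp only [MeasurableEquiv.piEquivPiSubtypeProd, MeasurableEquiv.symm_mk,
        MeasurableEquiv.coe_mk, Equiv.piEquivPiSubtypeProd, Equiv.symm_mk, Equiv.coe_fn_mk]
      rw [dif_pos (show q (ι a) from ⟨a, rfl⟩), this]
      exact Equiv.piCongrLeft_apply_apply (P := fun _ : Subtype q => ℝ) e u a
    · rw [Function.extend_apply' _ _ _ hi]
      simp [MeasurableEquiv.piEquivPiSubtypeProd, Equiv.piEquivPiSubtypeProd, hi]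
  rw [this]

theorem volume_vecMul_box_le {j : ℕ} (A : Matrix (Fin j) (Fin j) ℝ) (hA : A.det ≠ 0)
    (c l : Fin j → ℝ) (hl : ∀ i, 0 ≤ l i) :
    volume {u : Fin j → ℝ | ∀ i, |c i - Matrix.vecMul u A i| ≤ l i} ≤
      ENNReal.ofReal (|A.det|⁻¹ * ∏ i, (2 * l i)) := by
  have hdet : LinearMap.det (Matrix.toLin' A.transpose) ≠ 0 := by
    simpa [LinearMap.det_toLin'] using hA
  have hset : {u : Fin j → ℝ | ∀ i, |c i - Matrix.vecMul u A i| ≤ l i} =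
      Matrix.toLin' A.transpose ⁻¹' Set.Icc (fun i => c i - l i) (fun i => c i + l i) := by
    ext u
    simp only [Set.mem_ofPred_eq, Set.mem_preimage, Set.mem_Icc, Matrix.toLin'_apply,
      Matrix.mulVec_transpose, Pi.le_def, ← forall_and, abs_le]
    refine forall_congr' fun i => ?_
    constructor <;> rintro ⟨h1, h2⟩ <;> constructor <;> linarith
  rw [hset, Measure.addHaar_preimage_linearMap _ hdet, Real.volume_Icc_pi,
    LinearMap.det_toLin', Matrix.det_transpose, abs_inv, ENNReal.ofReal_mul (by positivity),
    ENNReal.ofReal_prod_of_nonneg (fun i _ => by have := hl i; positivity)]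
  gcongr with i
  apply le_of_eq
  ring

/-! ### General position of the coefficients -/

/-- A function that is polynomial along all lines through a point where it does not vanish is
nonzero almost everywhere. -/
theorem ae_ne_zero_of_polynomial_lines {V : Type*} [NormedAddCommGroup V] [NormedSpace ℝ V]
    [FiniteDimensional ℝ V] [MeasurableSpace V] [BorelSpace V] (μ : Measure V)
    [μ.IsAddHaarMeasure] (f : V → ℝ) (hf : Continuous f) (x₀ : V) (h₀ : f x₀ ≠ 0)
    (hpoly : ∀ v, ∃ p : Polynomial ℝ, ∀ t, f (x₀ + t • v) = p.eval t) :
    ∀ᵐ x ∂μ, f x ≠ 0 := by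
  have hmeas : MeasurableSet {z : V × ℝ | f (x₀ + z.2 • z.1) = 0} :=
    (isClosed_eq (by fun_prop) continuous_const).measurableSet
  have hlines : ∀ᵐ v ∂μ, ∀ᵐ t : ℝ, f (x₀ + t • v) ≠ 0 := by
    refine Eventually.of_forall fun v => ?_
    obtain ⟨p, hp⟩ := hpoly v
    have hp0 : p ≠ 0 := by
      rintro rfl
      apply h₀
      simpa using hp 0
    refine measure_mono_null (t := (p.roots.toFinset : Set ℝ)) ?_ (Finset.measure_zero _ _)
    intro t ht
    simp only [ne_eq, Set.mem_compl_iff, Set.mem_ofPred_eq, not_not, hp] at ht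
    simpa [hp0] using ht
  -- Each line meets the zero set in finitely many `t`. Exchanging the quantifiers gives one `t ≠ 0`
  -- that works for almost every direction, and `v ↦ x₀ + t • v` rescales Haar measure by a nonzero
  -- factor.
  rw [Measure.ae_ae_comm hmeas.compl] at hlines
  have hne : ∀ᵐ t : ℝ, t ≠ 0 := by simp [ae_iff]
  obtain ⟨t, ht, ht0⟩ := (hlines.and hne).exists
  rw [ae_iff] at ht ⊢
  simp only [ne_eq, not_not] at ht ⊢
  have himage : {v : V | f (x₀ + t • v) = 0} = (t • ·) ⁻¹' ((x₀ + ·) ⁻¹' {x | f x = 0}) := rfl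
  rw [himage, Measure.addHaar_preimage_smul μ ht0, measure_preimage_add, mul_eq_zero] at ht
  refine ht.resolve_left ?_
  simp [ht0]

/-- The minor with rows `g` and columns `f` of the user coefficients after zero forcing by the
adjugate of the noise coefficients. -/
def zfMinor {K N j : ℕ} (f : Fin j → Fin N) (g : Fin j → Fin K) (h : Coeff K N) :
    Matrix (Fin j) (Fin j) ℝ :=
  Matrix.of fun b i => Matrix.vecMul (h.1 (g b)) (Matrix.adjugate (Matrix.of h.2)) (f i)

theorem continuous_zfMinor_det {K N j : ℕ} (f : Fin j → Fin N) (g : Fin j → Fin K) :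
    Continuous fun h : Coeff K N => (zfMinor f g h).det := by
  refine Continuous.matrix_det (continuous_matrix fun b i => ?_)
  simp only [zfMinor, Matrix.of_apply]
  refine (continuous_apply (f i)).comp (Continuous.matrix_vecMul (by fun_prop)
    (Continuous.matrix_adjugate ?_))
  exact continuous_snd

theorem ae_zfMinor_det_ne_zero {K N j : ℕ} (f : Fin j → Fin N) (g : Fin j → Fin K)
    (hf : Function.Injective f) (hg : Function.Injective g) :
    ∀ᵐ h : Coeff K N, (zfMinor f g h).det ≠ 0 := by
  classical
  have : (volume : Measure (Coeff K N)).IsAddHaarMeasure := by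
    have hN : (volume : Measure (Fin N → ℝ)).IsAddHaarMeasure := inferInstance
    have h1 : (volume : Measure (Fin K → Fin N → ℝ)).IsAddHaarMeasure :=
      Measure.pi.isAddHaarMeasure fun _ => (volume : Measure (Fin N → ℝ))
    have h2 : (volume : Measure (Fin N → Fin N → ℝ)).IsAddHaarMeasure :=
      Measure.pi.isAddHaarMeasure fun _ => (volume : Measure (Fin N → ℝ))
    exact inferInstanceAs ((volume : Measure (Fin K → Fin N → ℝ)).prod volume).IsAddHaarMeasure
  -- Base point: `G = 1` and the user `g b` pointing along the basis vector `f b`, which turns the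
  -- minor into the identity matrix.
  refine ae_ne_zero_of_polynomial_lines _ _ (continuous_zfMinor_det f g)
    (Function.extend g (fun b => Pi.single (f b) 1) 0, (1 : Matrix (Fin N) (Fin N) ℝ)) ?_ ?_
  · have hadj : (Matrix.of (1 : Matrix (Fin N) (Fin N) ℝ)).adjugate = 1 := Matrix.adjugate_one
    have : zfMinor f g (Function.extend g (fun b => Pi.single (f b) 1) 0,
        (1 : Matrix (Fin N) (Fin N) ℝ)) = 1 := by
      ext b i
      simp only [zfMinor, Matrix.of_apply, hg.extend_apply, hadj, Matrix.vecMul_one,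
        Matrix.one_apply, Pi.single_apply, hf.eq_iff, eq_comm]
    rw [this]; simp
  · intro v
    set x₀ : Coeff K N := (Function.extend g (fun b => Pi.single (f b) 1) 0,
      (1 : Matrix (Fin N) (Fin N) ℝ))
    -- Along a line the entries are affine in `t`; computing over `Polynomial ℝ` and evaluating
    -- commutes with adjugate and determinant.
    let G : Matrix (Fin N) (Fin N) (Polynomial ℝ) :=
      Matrix.of fun m i => .C (x₀.2 m i) + .X * .C (v.2 m i)
    let H : Matrix (Fin j) (Fin N) (Polynomial ℝ) :=
      Matrix.of fun b i => .C (x₀.1 (g b) i) + .X * .C (v.1 (g b) i)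
    refine ⟨((H * G.adjugate).submatrix id f).det, fun t => ?_⟩
    rw [← Polynomial.coe_evalRingHom, RingHom.map_det]
    congr 1
    have hG : G.map (Polynomial.evalRingHom t) = Matrix.of (x₀ + t • v).2 := by
      ext m i; simp [G, mul_comm t]
    have hH : H.map (Polynomial.evalRingHom t) = Matrix.of fun b => (x₀ + t • v).1 (g b) := by
      ext m i; simp [H, mul_comm t]
    have hHG : (H * G.adjugate).map (Polynomial.evalRingHom t) =
        (Matrix.of fun b => (x₀ + t • v).1 (g b)) * (Matrix.of (x₀ + t • v).2).adjugate := by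
      rw [Matrix.map_mul, hH, ← hG]
      congr 1
      exact RingHom.map_adjugate _ _
    rw [RingHom.mapMatrix_apply, ← Matrix.submatrix_map, hHG]
    rfl

/-- Coefficients that are quantitatively in general position. -/
def goodSet (K N : ℕ) (L : ℝ) : Set (Coeff K N) :=
  {h | |(Matrix.of h.2).det| ≤ L ∧ ∀ (j : Fin (N + 1)) (f : Fin j → Fin N) (g : Fin j → Fin K),
    Function.Injective f → Function.Injective g → 1 ≤ L * |(zfMinor f g h).det|}

theorem measurableSet_goodSet (K N : ℕ) (L : ℝ) : MeasurableSet (goodSet K N L) := by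
  refine IsClosed.measurableSet ?_
  simp only [goodSet, Set.ofPred_and, Set.ofPred_forall]
  refine IsClosed.inter (isClosed_le (by fun_prop) continuous_const) ?_
  refine isClosed_iInter fun j => isClosed_iInter fun f => isClosed_iInter fun g =>
    isClosed_iInter fun _ => isClosed_iInter fun _ => isClosed_le continuous_const ?_
  exact continuous_const.mul (continuous_zfMinor_det f g).abs

theorem goodSet_mono {K N : ℕ} {L L' : ℝ} (hL : L ≤ L') :
    goodSet K N L ⊆ goodSet K N L' := fun h hh =>
  ⟨hh.1.trans hL, fun j f g hf hg => (hh.2 j f g hf hg).trans (by gcongr)⟩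

theorem ae_exists_mem_goodSet (K N : ℕ) :
    ∀ᵐ h : Coeff K N, ∃ L : ℕ, h ∈ goodSet K N L := by
  have h1 : ∀ᵐ h : Coeff K N, ∀ (j : Fin (N + 1)) (f : Fin j → Fin N) (g : Fin j → Fin K),
      Function.Injective f → Function.Injective g → (zfMinor f g h).det ≠ 0 := by
    simp only [ae_all_iff]
    exact fun j f g hf hg => ae_zfMinor_det_ne_zero f g hf hg
  filter_upwards [h1] with h hh
  have h2 : ∀ᶠ L : ℕ in atTop, |(Matrix.of h.2).det| ≤ L ∧ ∀ (j : Fin (N + 1))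
      (f : Fin j → Fin N) (g : Fin j → Fin K),
      Function.Injective f → Function.Injective g → 1 ≤ (L : ℝ) * |(zfMinor f g h).det| := by
    refine (tendsto_natCast_atTop_atTop.eventually_ge_atTop _).and ?_
    simp only [eventually_all]
    intro j f g hf hg
    exact (tendsto_natCast_atTop_atTop.atTop_mul_const
      (abs_pos.2 (hh j f g hf hg))).eventually_ge_atTop 1
  exact h2.exists

theorem exists_measure_compl_goodSet_le {K N : ℕ} (ν : Measure (Coeff K N))
    [IsProbabilityMeasure ν] (hν : ∀ᵐ h ∂ν, ∃ L : ℕ, h ∈ goodSet K N L)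
    (p : ENNReal) (hp : 0 < p) : ∃ L : ℝ, 0 ≤ L ∧ ν (goodSet K N L)ᶜ ≤ p := by
  have ht := tendsto_measure_iInter_atTop (μ := ν) (s := fun L : ℕ => (goodSet K N L)ᶜ)
    (fun L => (measurableSet_goodSet K N L).compl.nullMeasurableSet)
    (fun L L' hL => Set.compl_subset_compl.2 (goodSet_mono (by exact_mod_cast hL)))
    ⟨0, measure_ne_top _ _⟩
  have h0 : ν (⋂ L : ℕ, (goodSet K N L)ᶜ) = 0 := by
    rw [← Set.compl_iUnion]
    simpa [ae_iff, Set.compl_def] using hν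
  rw [h0] at ht
  obtain ⟨L, hL⟩ := (ht.eventually_le_const hp).exists
  exact ⟨L, L.cast_nonneg, hL⟩

theorem exists_gaussian_box (N : ℕ) (p : ENNReal) (hp : 0 < p) :
    ∃ B : ℝ, 0 ≤ B ∧ Measure.pi (fun _ : Fin N => gaussianReal 0 1) {z | ∃ m, B < |z m|} ≤ p := by
  set μ := Measure.pi (fun _ : Fin N => gaussianReal 0 1)
  have hc : ∀ B : ℕ, MeasurableSet {z : Fin N → ℝ | ∃ m, (B : ℝ) < |z m|} := fun B => by
    simp only [Set.ofPred_exists]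
    exact MeasurableSet.iUnion fun m => (isOpen_lt continuous_const (by fun_prop)).measurableSet
  have ht := tendsto_measure_iInter_atTop (μ := μ)
    (s := fun B : ℕ => {z : Fin N → ℝ | ∃ m, (B : ℝ) < |z m|})
    (fun B => (hc B).nullMeasurableSet)
    (fun B B' hB z ⟨m, hm⟩ => ⟨m, lt_of_le_of_lt (by exact_mod_cast hB) hm⟩)
    ⟨0, measure_ne_top _ _⟩
  have h0 : (⋂ B : ℕ, {z : Fin N → ℝ | ∃ m, (B : ℝ) < |z m|}) = ∅ := by
    ext z
    simp only [Set.mem_iInter, Set.mem_ofPred_eq, Set.mem_empty_iff_false, iff_false, not_forall,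
      not_exists, not_lt]
    have : ∀ᶠ B : ℕ in atTop, ∀ m, |z m| ≤ B :=
      eventually_all.2 fun m => tendsto_natCast_atTop_atTop.eventually_ge_atTop _
    exact this.exists
  rw [h0, measure_empty] at ht
  obtain ⟨B, hB⟩ := (ht.eventually_le_const hp).exists
  exact ⟨B, B.cast_nonneg, hB⟩

/-! ### Explaining a single slot -/

/-- The residual `r` is explained by noise terms of size at most `B`, and the coefficients are in
general position. -/
def slotSet {K N : ℕ} (E : Exponents K N) (P L B : ℝ) : Set (Coeff K N × (Fin N → ℝ)) :=
  {x | x.1 ∈ goodSet K N L ∧ ∀ m, |Matrix.vecMul x.2 (Matrix.adjugate (Matrix.of x.1.2)) m| ≤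
    |(Matrix.of x.1.2).det| * (Real.sqrt (P ^ E.noiseLevel m) * B)}

theorem measurableSet_slotSet {K N : ℕ} (E : Exponents K N) (P L B : ℝ) :
    MeasurableSet (slotSet E P L B) := by
  have hset : slotSet E P L B = Prod.fst ⁻¹' goodSet K N L ∩
      ⋂ m, {x : Coeff K N × (Fin N → ℝ) |
        |Matrix.vecMul x.2 (Matrix.adjugate (Matrix.of x.1.2)) m| ≤
          |(Matrix.of x.1.2).det| * (Real.sqrt (P ^ E.noiseLevel m) * B)} := by
    ext x; simp [slotSet]
  rw [hset]
  refine (measurable_fst (measurableSet_goodSet K N L)).inter (IsClosed.measurableSet ?_)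
  refine isClosed_iInter fun m => isClosed_le ?_ ?_
  · refine ((continuous_apply m).comp (Continuous.matrix_vecMul (by fun_prop)
      (Continuous.matrix_adjugate ?_))).abs
    exact continuous_snd.comp continuous_fst
  · refine Continuous.mul (Continuous.abs (Continuous.matrix_det ?_)) continuous_const
    exact continuous_snd.comp continuous_fst

/-- Since `G * adjugate G = det G • 1`, the adjugate separates the noise terms up to the common
factor `det G`. This is why the true tuple explains every slot with good coefficients and bounded
noise. -/
theorem noise_mem_slotSet {K N : ℕ} (E : Exponents K N) (P L B : ℝ) {h : Coeff K N}
    (hh : h ∈ goodSet K N L) {z : Fin N → ℝ} (hz : ∀ m, |z m| ≤ B) :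
    (h, ∑ m, (Real.sqrt (P ^ E.noiseLevel m) * z m) • h.2 m) ∈ slotSet E P L B := by
  refine ⟨hh, fun m => ?_⟩
  have : ∑ m, (Real.sqrt (P ^ E.noiseLevel m) * z m) • h.2 m =
      Matrix.vecMul (fun m => Real.sqrt (P ^ E.noiseLevel m) * z m) (Matrix.of h.2) := by
    ext i
    simp [Matrix.vecMul, dotProduct]
  simp only [this, Matrix.vecMul_vecMul, Matrix.mul_adjugate, Matrix.vecMul_smul,
    Matrix.vecMul_one, Pi.smul_apply, smul_eq_mul, abs_mul, abs_of_nonneg (Real.sqrt_nonneg _)]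
  gcongr
  exact hz m

theorem sqrt_rpow_eq {P : ℝ} (hP : 0 < P) (x : ℝ) : Real.sqrt (P ^ x) = P ^ (x / 2) := by
  rw [Real.sqrt_eq_rpow, ← Real.rpow_mul hP.le]
  ring_nf

theorem prod_rpow_half {P : ℝ} (hP : 0 < P) {ι : Type*} (s : Finset ι) (x : ι → ℝ) :
    ∏ i ∈ s, P ^ (x i / 2) = P ^ ((∑ i ∈ s, x i) / 2) := by
  rw [← Real.rpow_sum_of_pos hP, Finset.sum_div]

/-- The channel input of user `k` for the normalized symbol `x`. -/
def scaled {K N : ℕ} (E : Exponents K N) (P : ℝ) (x : Fin K → ℝ) (k : Fin K) : ℝ :=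
  Real.sqrt (P ^ (-E.powerExp k)) * x k

/-- Isolates the linear dependence of the residual on the `j` fresh symbols `u`; setting them to
zero gives the constant term. -/
theorem received_extend_eq {K N j : ℕ} (E : Exponents K N) {P : ℝ} (hP : 0 < P)
    (h : Coeff K N) (z : Fin N → ℝ) (g : Fin j → Fin K) (hg : Function.Injective g)
    (x v : Fin K → ℝ) (u : Fin j → ℝ) :
    received E P h (fun k => scaled E P x k - scaled E P (Function.extend g u v) k) z =
      received E P h (fun k => scaled E P x k - scaled E P (Function.extend g 0 v) k) z -
      ∑ b, (u b * P ^ ((E.strength (g b) - E.powerExp (g b)) / 2)) • h.1 (g b) := by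
  have h1 : ∑ b, (u b * P ^ ((E.strength (g b) - E.powerExp (g b)) / 2)) • h.1 (g b) =
      ∑ k, (Real.sqrt (P ^ E.strength k) * (Real.sqrt (P ^ (-E.powerExp k)) *
        (Function.extend g u v k - Function.extend g 0 v k))) • h.1 k := by
    refine Fintype.sum_of_injective g hg _ _ (fun k hk => ?_) fun b => ?_
    · rw [Function.extend_apply' _ _ _ hk, Function.extend_apply' _ _ _ hk]
      simp
    · rw [hg.extend_apply, hg.extend_apply, sqrt_rpow_eq hP, sqrt_rpow_eq hP, ← mul_assoc,
        ← Real.rpow_add hP, mul_comm]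
      simp only [Pi.zero_apply, sub_zero]
      ring_nf
  rw [h1, received, received, add_sub_right_comm, ← Finset.sum_sub_distrib]
  congr 1
  refine Finset.sum_congr rfl fun k _ => ?_
  rw [← sub_smul, scaled, scaled, scaled]
  congr 1
  ring

theorem continuous_received {X : Type*} [TopologicalSpace X] {K N : ℕ} (E : Exponents K N)
    (P : ℝ) {h : X → Coeff K N} {T : X → Fin K → ℝ} {Z : X → Fin N → ℝ} (hh : Continuous h)
    (hT : Continuous T) (hZ : Continuous Z) :
    Continuous fun x => received E P (h x) (T x) (Z x) := by
  unfold received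
  have h1 : Continuous fun x => (h x).1 := hh.fst
  have h2 : Continuous fun x => (h x).2 := hh.snd
  fun_prop

/-- Conditionally on all other symbols, the zero-forced residual in the coordinates `f` is affine in
the symbols of `w'` for the users `g b`, with matrix a diagonal of user amplitudes times `zfMinor`.
The probability is at most the box volume over its determinant: noise amplitudes over user
amplitudes, with `L` controlling the remaining factors. -/
theorem slot_probability_le {K N j : ℕ} (E : Exponents K N) {P : ℝ} (hP : 0 < P) {L B : ℝ}
    (hL : 0 ≤ L) (hB : 0 ≤ B) (hj : j ≤ N) (f : Fin j → Fin N) (g : Fin j → Fin K)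
    (hf : Function.Injective f) (hg : Function.Injective g) {M : Fin K → ℕ}
    (w w' : (k : Fin K) → Fin (M k)) (hw : ∀ b, w (g b) ≠ w' (g b)) (h : Coeff K N)
    (z : Fin N → ℝ) :
    unitCube ((k : Fin K) × Fin (M k)) {x | (h, received E P h (fun k =>
        scaled E P (fun k => x ⟨k, w k⟩) k - scaled E P (fun k => x ⟨k, w' k⟩) k) z) ∈
          slotSet E P L B} ≤
      ENNReal.ofReal (L * (2 * (L * B)) ^ j * P ^ ((∑ i, E.noiseLevel (f i) -
        ∑ b, (E.strength (g b) - E.powerExp (g b))) / 2)) := by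
  by_cases hh : h ∈ goodSet K N L
  swap
  · simp [slotSet, hh]
  let ι : Fin j → (k : Fin K) × Fin (M k) := fun b => ⟨g b, w' (g b)⟩
  have hι : Function.Injective ι := fun b b' hb => hg (congrArg Sigma.fst hb)
  refine unitCube_le_of_extend ι hι ?_ _ fun v => ?_
  · refine (measurableSet_slotSet E P L B).preimage (Continuous.measurable ?_)
    refine continuous_const.prodMk (continuous_received E P continuous_const ?_ continuous_const)
    unfold scaled
    fun_prop
  -- The codeword of `w` does not involve the fresh symbols, because the messages differ at every `g
  -- b`.
  have hx1 : ∀ u : Fin j → ℝ, (fun k => Function.extend ι u v ⟨k, w k⟩) =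
      fun k => v ⟨k, w k⟩ := fun u => by
    funext k
    refine Function.extend_apply' _ _ _ ?_
    rintro ⟨b, hb⟩
    simp only [ι, Sigma.mk.injEq] at hb
    obtain ⟨rfl, hb⟩ := hb
    exact hw b (eq_of_heq hb).symm
  have hx2 : ∀ u : Fin j → ℝ, (fun k => Function.extend ι u v ⟨k, w' k⟩) =
      Function.extend g u (fun k => v ⟨k, w' k⟩) := fun u => by
    funext k
    by_cases hk : ∃ b, g b = k
    · obtain ⟨b, rfl⟩ := hk
      rw [hg.extend_apply]
      exact hι.extend_apply u v b
    · rw [Function.extend_apply' _ _ _ hk]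
      refine Function.extend_apply' _ _ _ ?_
      rintro ⟨b, hb⟩
      exact hk ⟨b, congrArg Sigma.fst hb⟩
  set β : Fin j → ℝ := fun b => P ^ ((E.strength (g b) - E.powerExp (g b)) / 2) with hβ
  set A : Matrix (Fin j) (Fin j) ℝ := Matrix.diagonal β * zfMinor f g h with hA
  set Δ := (zfMinor f g h).det with hΔ
  have hΔ1 : 1 ≤ L * |Δ| := hh.2 ⟨j, by omega⟩ f g hf hg
  have hΔ0 : 0 < |Δ| := by
    rcases (abs_nonneg Δ).eq_or_lt with h0 | h0
    · rw [← h0] at hΔ1; norm_num at hΔ1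
    · exact h0
  have hβ0 : 0 < ∏ b, β b := Finset.prod_pos fun b _ => Real.rpow_pos_of_pos hP _
  have hdet : A.det = (∏ b, β b) * Δ := by rw [hA, Matrix.det_mul, Matrix.det_diagonal]
  have hdet0 : A.det ≠ 0 := by
    rw [hdet]; exact mul_ne_zero hβ0.ne' (abs_pos.1 hΔ0)
  set D := |(Matrix.of h.2).det| with hD
  have hDL : D ≤ L := hh.1
  have hD0 : 0 ≤ D := abs_nonneg _
  let x : Fin K → ℝ := fun k => v ⟨k, w k⟩
  let y : Fin K → ℝ := fun k => v ⟨k, w' k⟩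
  let c : Fin j → ℝ := fun i => Matrix.vecMul (received E P h (fun k => scaled E P x k -
    scaled E P (Function.extend g 0 y) k) z) (Matrix.adjugate (Matrix.of h.2)) (f i)
  let l : Fin j → ℝ := fun i => D * (Real.sqrt (P ^ E.noiseLevel (f i)) * B)
  have hl : ∀ i, 0 ≤ l i := fun i => by positivity
  refine (measure_mono ?_).trans ((volume_vecMul_box_le A hdet0 c l hl).trans
    (ENNReal.ofReal_le_ofReal ?_))
  · intro u hu i
    have hu2 := hu.2 (f i)
    simp only [hx1, hx2] at hu2
    rw [received_extend_eq E hP h z g hg] at hu2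
    have he : c i - Matrix.vecMul u A i = Matrix.vecMul (received E P h (fun k => scaled E P x k -
        scaled E P (Function.extend g 0 y) k) z - ∑ b, (u b * β b) • h.1 (g b))
          (Matrix.adjugate (Matrix.of h.2)) (f i) := by
      rw [Matrix.sub_vecMul, Pi.sub_apply, Matrix.sum_vecMul, Finset.sum_apply]
      congr 1
      rw [hA, ← Matrix.vecMul_vecMul, Matrix.vecMul, dotProduct]
      refine Finset.sum_congr rfl fun b _ => ?_
      rw [Matrix.vecMul_diagonal, Matrix.smul_vecMul, Pi.smul_apply, smul_eq_mul]
      rfl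
    rw [he]
    exact hu2
  · have hprod : ∏ i, (2 * l i) = (2 * (D * B)) ^ j * P ^ ((∑ i, E.noiseLevel (f i)) / 2) := by
      have hconst : (2 * (D * B)) ^ j = ∏ _i : Fin j, 2 * (D * B) := by simp
      rw [← prod_rpow_half hP, hconst, ← Finset.prod_mul_distrib]
      refine Finset.prod_congr rfl fun i _ => ?_
      simp only [l]
      rw [sqrt_rpow_eq hP]
      ring
    have hβp : ∏ b, β b = P ^ ((∑ b, (E.strength (g b) - E.powerExp (g b))) / 2) :=
      prod_rpow_half hP _ _
    rw [hprod, hdet, abs_mul, abs_of_pos hβ0, mul_inv, hβp, sub_div, Real.rpow_sub hP]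
    have hinv : |Δ|⁻¹ ≤ L := by
      rw [inv_le_iff_one_le_mul₀ hΔ0]; exact hΔ1
    calc _ = |Δ|⁻¹ * (2 * (D * B)) ^ j * (P ^ ((∑ i, E.noiseLevel (f i)) / 2) /
          P ^ ((∑ b, (E.strength (g b) - E.powerExp (g b))) / 2)) := by
          rw [div_eq_mul_inv]; ring
      _ ≤ _ := by gcongr

theorem received_sub_received {K N : ℕ} (E : Exponents K N) (P : ℝ) (h : Coeff K N)
    (T T' : Fin K → ℝ) (z : Fin N → ℝ) :
    received E P h T z - received E P h T' 0 = received E P h (fun k => T k - T' k) z := by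
  simp only [received, Pi.zero_apply, mul_zero, zero_smul, Finset.sum_const_zero, add_zero]
  rw [add_sub_right_comm, ← Finset.sum_sub_distrib]
  congr 1
  refine Finset.sum_congr rfl fun k _ => ?_
  rw [← sub_smul, mul_sub]

/-! ### The code and its error events -/

theorem measurableSet_card_ge {X : Type*} [MeasurableSpace X] {n : ℕ} (m : ℕ)
    (A : Fin n → Set X) (hA : ∀ t, MeasurableSet (A t)) :
    MeasurableSet {x | ∃ T : Finset (Fin n), m ≤ T.card ∧ ∀ t ∈ T, x ∈ A t} := by
  have : {x | ∃ T : Finset (Fin n), m ≤ T.card ∧ ∀ t ∈ T, x ∈ A t} =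
      ⋃ T : Finset (Fin n), ⋃ _ : m ≤ T.card, ⋂ t ∈ T, A t := by
    ext x; simp
  rw [this]
  exact MeasurableSet.iUnion fun T => MeasurableSet.iUnion fun _ =>
    T.measurableSet_biInter fun t _ => hA t

/-- The normalized symbols of a codebook sent in one slot for the message tuple `w`. -/
def symbols {K : ℕ} {M : Fin K → ℕ} (x : (k : Fin K) × Fin (M k) → ℝ)
    (w : (k : Fin K) → Fin (M k)) (k : Fin K) : ℝ :=
  x ⟨k, w k⟩

/-- Received blocks that the message tuple `w` explains in at least `m` slots. -/
def explainedSet {K N n : ℕ} {M : Fin K → ℕ} (E : Exponents K N) (P L B : ℝ) (m : ℕ)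
    (X : Fin n → (k : Fin K) × Fin (M k) → ℝ) (w : (k : Fin K) → Fin (M k)) :
    Set ((Fin n → Fin N → ℝ) × (Fin n → Coeff K N)) :=
  {y | ∃ T : Finset (Fin n), m ≤ T.card ∧ ∀ t ∈ T,
    (y.2 t, y.1 t - received E P (y.2 t) (scaled E P (symbols (X t) w)) 0) ∈ slotSet E P L B}

theorem measurableSet_explainedSet {K N n : ℕ} {M : Fin K → ℕ} (E : Exponents K N) (P L B : ℝ)
    (m : ℕ) (X : Fin n → (k : Fin K) × Fin (M k) → ℝ) (w : (k : Fin K) → Fin (M k)) :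
    MeasurableSet (explainedSet E P L B m X w) := by
  refine measurableSet_card_ge m (fun t => (fun y : (Fin n → Fin N → ℝ) × (Fin n → Coeff K N) =>
    (y.2 t, y.1 t - received E P (y.2 t) (scaled E P (symbols (X t) w)) 0)) ⁻¹'
      slotSet E P L B) fun t => (measurableSet_slotSet E P L B).preimage (Continuous.measurable ?_)
  have h2 : Continuous fun y : (Fin n → Fin N → ℝ) × (Fin n → Coeff K N) => y.2 t := by fun_prop
  exact h2.prodMk (Continuous.sub (by fun_prop)
    (continuous_received E P h2 continuous_const continuous_const))

open Classical in
/-- The unique element satisfying a predicate, with a default if there is none. -/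
def uniqueChoice {W : Type*} (w₀ : W) (A : W → Prop) : W :=
  if h : ∃ w, A w ∧ ∀ w', A w' → w' = w then h.choose else w₀

theorem uniqueChoice_eq {W : Type*} (w₀ : W) (A : W → Prop) {w : W} (hw : A w)
    (hu : ∀ w', A w' → w' = w) : uniqueChoice w₀ A = w := by
  have h : ∃ w, A w ∧ ∀ w', A w' → w' = w := ⟨w, hw, hu⟩
  rw [uniqueChoice, dif_pos h]
  exact hu _ h.choose_spec.1

/-- The block code with codebook `X` whose decoder looks for the only message tuple explaining the
received block. -/
def codeOf {K N n : ℕ} {M : Fin K → ℕ} (E : Exponents K N) (P L B : ℝ) (m : ℕ)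
    (X : Fin n → (k : Fin K) × Fin (M k) → ℝ) (w₀ : (k : Fin K) → Fin (M k)) : Code K N n M where
  enc k w t := Real.sqrt (P ^ (-E.powerExp k)) * X t ⟨k, w⟩
  dec y := uniqueChoice w₀ fun w => y ∈ explainedSet E P L B m X w
  measurable_dec := by
    -- There are finitely many message tuples, so predicates on them form a discrete measurable
    -- space.
    refine (Measurable.of_discrete (f := uniqueChoice w₀)).comp (measurable_pi_iff.2 fun w => ?_)
    exact measurableSet_setOfPred.1 (measurableSet_explainedSet E P L B m X w)

theorem codeOf_powerConstrained {K N n : ℕ} {M : Fin K → ℕ} (E : Exponents K N) {P : ℝ}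
    (hP : 0 < P) (L B : ℝ) (m : ℕ) (X : Fin n → (k : Fin K) × Fin (M k) → ℝ)
    (w₀ : (k : Fin K) → Fin (M k)) (hX : ∀ t i, X t i ∈ Set.Icc (0 : ℝ) 1) :
    (codeOf E P L B m X w₀).PowerConstrained E P := by
  intro k w
  calc ∑ t, (Real.sqrt (P ^ (-E.powerExp k)) * X t ⟨k, w⟩) ^ 2
      ≤ ∑ _t : Fin n, P ^ (-E.powerExp k) := by
        refine Finset.sum_le_sum fun t _ => ?_
        rw [mul_pow, Real.sq_sqrt (Real.rpow_nonneg hP.le _)]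
        refine mul_le_of_le_one_right (Real.rpow_nonneg hP.le _) ?_
        exact pow_le_one₀ (hX t _).1 (hX t _).2
    _ = n * P ^ (-E.powerExp k) := by simp

/-- Codebook, coefficients and noise for which `w'` explains at least `m` slots when `w` is
sent. -/
def confusionSet {K N n : ℕ} {M : Fin K → ℕ} (E : Exponents K N) (P L B : ℝ) (m : ℕ)
    (w w' : (k : Fin K) → Fin (M k)) :
    Set ((Fin n → (k : Fin K) × Fin (M k) → ℝ) × (Fin n → Coeff K N) × (Fin n → Fin N → ℝ)) :=
  {y | ∃ T : Finset (Fin n), m ≤ T.card ∧ ∀ t ∈ T, (y.2.1 t, received E P (y.2.1 t)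
    (fun k => scaled E P (symbols (y.1 t) w) k - scaled E P (symbols (y.1 t) w') k) (y.2.2 t)) ∈
      slotSet E P L B}

theorem measurableSet_confusionSet {K N n : ℕ} {M : Fin K → ℕ} (E : Exponents K N) (P L B : ℝ)
    (m : ℕ) (w w' : (k : Fin K) → Fin (M k)) :
    MeasurableSet (confusionSet (n := n) E P L B m w w') := by
  let φ : ((k : Fin K) × Fin (M k) → ℝ) × Coeff K N × (Fin N → ℝ) → Coeff K N × (Fin N → ℝ) :=
    fun y => (y.2.1, received E P y.2.1
      (fun k => scaled E P (symbols y.1 w) k - scaled E P (symbols y.1 w') k) y.2.2)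
  have hφ : Measurable φ := by
    refine Continuous.measurable (Continuous.prodMk (by fun_prop)
      (continuous_received E P (by fun_prop) ?_ (by fun_prop)))
    unfold scaled symbols
    fun_prop
  exact measurableSet_card_ge m (fun t => (fun y : (Fin n → (k : Fin K) × Fin (M k) → ℝ) ×
    (Fin n → Coeff K N) × (Fin n → Fin N → ℝ) => φ (y.1 t, y.2.1 t, y.2.2 t)) ⁻¹'
      slotSet E P L B)
    fun t => (hφ.comp (by fun_prop)) (measurableSet_slotSet E P L B)

/-- The channel misbehaves in at least `r` slots. -/
def outageSet (K N n : ℕ) (L B : ℝ) (r : ℕ) : Set ((Fin n → Coeff K N) × (Fin n → Fin N → ℝ)) :=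
  {x | ∃ T : Finset (Fin n), r ≤ T.card ∧ ∀ t ∈ T, x.1 t ∈ (goodSet K N L)ᶜ} ∪
    {x | ∃ T : Finset (Fin n), r ≤ T.card ∧ ∀ t ∈ T, x.2 t ∈ {z | ∃ i, B < |z i|}}

/-- Outside outage, fewer than `r` slots have bad coefficients and fewer than `r` large noise. The
true tuple then explains at least `n - 2 * r ≥ m` slots, so an error requires a rival that explains
`m` slots too. -/
theorem errorEvent_codeOf_subset {K N n : ℕ} {M : Fin K → ℕ} (E : Exponents K N) (P L B : ℝ)
    (m r : ℕ) (hm : m + 2 * r ≤ n) (X : Fin n → (k : Fin K) × Fin (M k) → ℝ)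
    (w₀ w : (k : Fin K) → Fin (M k)) :
    (codeOf (N := N) E P L B m X w₀).errorEvent E P w ⊆ outageSet K N n L B r ∪
      ⋃ w' ∈ Finset.univ.erase w, Prod.mk X ⁻¹' confusionSet E P L B m w w' := by
  classical
  intro x hx
  by_contra hcon
  simp only [outageSet, Set.mem_union, not_or, Set.mem_iUnion, not_exists] at hcon
  obtain ⟨⟨hc1, hc2⟩, hc3⟩ := hcon
  refine hx (uniqueChoice_eq _ _ ?_ fun w' hw' => ?_)
  · set T₁ := Finset.univ.filter fun t => x.1 t ∈ (goodSet K N L)ᶜ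
    set T₂ := Finset.univ.filter fun t => x.2 t ∈ {z : Fin N → ℝ | ∃ i, B < |z i|}
    have h1 : T₁.card < r := by
      by_contra hT
      exact hc1 ⟨T₁, not_lt.1 hT, fun t ht => (Finset.mem_filter.1 ht).2⟩
    have h2 : T₂.card < r := by
      by_contra hT
      exact hc2 ⟨T₂, not_lt.1 hT, fun t ht => (Finset.mem_filter.1 ht).2⟩
    refine ⟨(T₁ ∪ T₂)ᶜ, ?_, fun t ht => ?_⟩
    · rw [Finset.card_compl, Fintype.card_fin]
      have := Finset.card_union_le T₁ T₂
      omega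
    · simp only [T₁, T₂, Finset.mem_compl, Finset.mem_union, Finset.mem_filter, Finset.mem_univ,
        true_and, not_or, Set.mem_compl_iff, not_not, Set.mem_ofPred_eq, not_exists, not_lt] at ht
      have he := received_sub_received E P (x.1 t) (scaled E P (symbols (X t) w))
        (scaled E P (symbols (X t) w)) (x.2 t)
      have hn : received E P (x.1 t) (fun k => scaled E P (symbols (X t) w) k -
          scaled E P (symbols (X t) w) k) (x.2 t) =
          ∑ m, (Real.sqrt (P ^ E.noiseLevel m) * x.2 t m) • (x.1 t).2 m := by
        simp [received]
      have hs := noise_mem_slotSet E P L B ht.1 ht.2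
      rw [← hn, ← he] at hs
      exact hs
  · by_contra hne
    refine hc3 w' (Finset.mem_erase.2 ⟨hne, Finset.mem_univ _⟩) ?_
    obtain ⟨T, hT, h⟩ := hw'
    refine ⟨T, hT, fun t ht => ?_⟩
    have h' := h t ht
    have he := received_sub_received E P (x.1 t) (scaled E P (symbols (X t) w))
      (scaled E P (symbols (X t) w')) (x.2 t)
    simp only
    rw [← he]
    exact h'

instance {K N : ℕ} (ν : Measure (Coeff K N)) [IsProbabilityMeasure ν] (n : ℕ) :
    IsProbabilityMeasure (blockLaw ν n) := by
  unfold blockLaw; infer_instance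

theorem blockLaw_outageSet_le {K N n : ℕ} (ν : Measure (Coeff K N)) [IsProbabilityMeasure ν]
    (L B : ℝ) (r : ℕ) (p : ENNReal) (hp : p ≤ 1) (hL : ν (goodSet K N L)ᶜ ≤ p)
    (hB : Measure.pi (fun _ : Fin N => gaussianReal 0 1) {z | ∃ i, B < |z i|} ≤ p) :
    blockLaw ν n (outageSet K N n L B r) ≤ 2 * (2 ^ n * p ^ r) := by
  rw [two_mul]
  refine (measure_union_le _ _).trans (add_le_add ?_ ?_)
  · have h := pi_card_ge_le (n := n) ν (fun _ => (goodSet K N L)ᶜ) p hp (fun _ => hL) r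
    refine le_of_eq_of_le ?_ h
    have : {x : (Fin n → Coeff K N) × (Fin n → Fin N → ℝ) | ∃ T : Finset (Fin n), r ≤ T.card ∧
        ∀ t ∈ T, x.1 t ∈ (goodSet K N L)ᶜ} = {x : Fin n → Coeff K N | ∃ T : Finset (Fin n),
          r ≤ T.card ∧ ∀ t ∈ T, x t ∈ (goodSet K N L)ᶜ} ×ˢ Set.univ := by
      ext x; simp
    rw [this, blockLaw, Measure.prod_prod, measure_univ, mul_one]
  · have h := pi_card_ge_le (n := n) (Measure.pi (fun _ : Fin N => gaussianReal 0 1))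
      (fun _ => {z | ∃ i, B < |z i|}) p hp (fun _ => hB) r
    refine le_of_eq_of_le ?_ h
    have : {x : (Fin n → Coeff K N) × (Fin n → Fin N → ℝ) | ∃ T : Finset (Fin n), r ≤ T.card ∧
        ∀ t ∈ T, x.2 t ∈ {z : Fin N → ℝ | ∃ i, B < |z i|}} =
          Set.univ ×ˢ {x : Fin n → Fin N → ℝ | ∃ T : Finset (Fin n),
            r ≤ T.card ∧ ∀ t ∈ T, x t ∈ {z : Fin N → ℝ | ∃ i, B < |z i|}} := by
      ext x; simp
    rw [this, blockLaw, Measure.prod_prod, measure_univ, one_mul]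

/-! ### The random coding bound -/

theorem ae_mem_Icc_pi_unitCube (n : ℕ) (I : Type*) [Fintype I] :
    ∀ᵐ X ∂(Measure.pi fun _ : Fin n => unitCube I), ∀ t i, X t i ∈ Set.Icc (0 : ℝ) 1 := by
  simp only [ae_all_iff]
  intro t i
  have h1 : ∀ᵐ x ∂(unitCube I), x i ∈ Set.Icc (0 : ℝ) 1 :=
    (measurePreserving_eval (fun _ : I => volume.restrict (Set.Icc (0 : ℝ) 1))
      i).quasiMeasurePreserving.ae (ae_restrict_mem measurableSet_Icc)
  exact (measurePreserving_eval (fun _ : Fin n => unitCube I) t).quasiMeasurePreserving.ae h1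

/-- Random coding bound for uniformly distributed codebooks. -/
theorem exists_code_avgError_le {K N n : ℕ} {M : Fin K → ℕ} (hM : ∀ k, 0 < M k)
    (E : Exponents K N) {P : ℝ} (hP : 0 < P) (ν : Measure (Coeff K N)) [IsProbabilityMeasure ν]
    (L B : ℝ) (m r : ℕ) (hm : m + 2 * r ≤ n) (p : ENNReal) (hp : p ≤ 1)
    (hL : ν (goodSet K N L)ᶜ ≤ p)
    (hB : Measure.pi (fun _ : Fin N => gaussianReal 0 1) {z | ∃ i, B < |z i|} ≤ p)
    (b : ((k : Fin K) → Fin (M k)) → ((k : Fin K) → Fin (M k)) → ENNReal)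
    (hb1 : ∀ w w', w' ≠ w → b w w' ≤ 1)
    (hb : ∀ w w', w' ≠ w → ∀ h z, unitCube ((k : Fin K) × Fin (M k)) {x | (h, received E P h
      (fun k => scaled E P (symbols x w) k - scaled E P (symbols x w') k) z) ∈
        slotSet E P L B} ≤ b w w')
    (e : ENNReal) (he : ∀ w, ∑ w' ∈ Finset.univ.erase w, 2 ^ n * b w w' ^ m ≤ e)
    (e' : ℝ) (he0 : 0 ≤ e') (he' : 2 * (2 ^ n * p ^ r) + e ≤ ENNReal.ofReal e') :
    ∃ c : Code K N n M, c.PowerConstrained E P ∧ c.avgError E ν P ≤ e' := by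
  classical
  let W := (k : Fin K) → Fin (M k)
  let w₀ : W := fun k => ⟨0, hM k⟩
  let I := (k : Fin K) × Fin (M k)
  let μ := Measure.pi fun _ : Fin n => unitCube I
  let ρ := blockLaw ν n
  let F : (Fin n → I → ℝ) → ENNReal := fun X =>
    ∑ w : W, ∑ w' ∈ Finset.univ.erase w, ρ (Prod.mk X ⁻¹' confusionSet E P L B m w w')
  have hmeas : ∀ w w' : W, Measurable fun X : Fin n → I → ℝ =>
      ρ (Prod.mk X ⁻¹' confusionSet E P L B m w w') := fun w w' =>
    measurable_measure_prodMk_left (measurableSet_confusionSet E P L B m w w')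
  have hF : Measurable F :=
    Finset.measurable_sum _ fun w _ => Finset.measurable_sum _ fun w' _ => hmeas w w'
  have hpair : ∀ w w' : W, w' ≠ w →
      ∫⁻ X, ρ (Prod.mk X ⁻¹' confusionSet E P L B m w w') ∂μ ≤ 2 ^ n * b w w' ^ m := by
    intro w w' hne
    have hs := measurableSet_confusionSet (n := n) E P L B m w w'
    -- Integrate over the codebook first: for fixed coefficients and noise, the slots of the
    -- codebook are independent.
    rw [← Measure.prod_apply hs, Measure.prod_apply_symm hs]
    calc _ ≤ ∫⁻ _, 2 ^ n * b w w' ^ m ∂ρ := lintegral_mono fun ω => ?_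
      _ = _ := by simp
    exact pi_card_ge_le (unitCube I) (fun t => {x | (ω.1 t, received E P (ω.1 t)
      (fun k => scaled E P (symbols x w) k - scaled E P (symbols x w') k) (ω.2 t)) ∈
        slotSet E P L B}) _ (hb1 w w' hne) (fun t => hb w w' hne _ _) m
  have hFint : ∫⁻ X, F X ∂μ ≤ ∑ _w : W, e := by
    rw [lintegral_finsetSum _ fun w _ => Finset.measurable_sum _ fun w' _ => hmeas w w']
    refine Finset.sum_le_sum fun w _ => ?_
    rw [lintegral_finsetSum _ fun w' _ => hmeas w w']
    exact (Finset.sum_le_sum fun w' hw' => hpair w w' (Finset.ne_of_mem_erase hw')).trans (he w)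
  -- Some codebook does at least as well as the mean while avoiding the null set where symbols leave
  -- `[0, 1]`, so the power constraint holds for every codeword.
  obtain ⟨X, hXN, hXF⟩ := exists_notMem_null_le_lintegral hF.aemeasurable
    (ae_iff.1 (ae_mem_Icc_pi_unitCube n I))
  have hX : ∀ t i, X t i ∈ Set.Icc (0 : ℝ) 1 := not_not.1 hXN
  refine ⟨codeOf E P L B m X w₀, codeOf_powerConstrained E hP L B m X w₀ hX, ?_⟩
  have hWcard : (∏ k, (M k : ℝ)) = Fintype.card W := by simp [W]
  have hWpos : (0 : ℝ) < Fintype.card W := by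
    rw [← hWcard]; exact Finset.prod_pos fun k _ => by exact_mod_cast hM k
  rw [Code.avgError, hWcard, div_le_iff₀ hWpos]
  have hsum : ∑ w : W, ρ ((codeOf E P L B m X w₀).errorEvent E P w) ≤
      ENNReal.ofReal (e' * Fintype.card W) := by
    calc _ ≤ ∑ w : W, (2 * (2 ^ n * p ^ r) + ∑ w' ∈ Finset.univ.erase w,
          ρ (Prod.mk X ⁻¹' confusionSet E P L B m w w')) := by
          refine Finset.sum_le_sum fun w _ => ?_
          refine (measure_mono (errorEvent_codeOf_subset E P L B m r hm X w₀ w)).trans ?_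
          refine (measure_union_le _ _).trans (add_le_add ?_ (measure_biUnion_finset_le _ _))
          exact blockLaw_outageSet_le ν L B r p hp hL hB
      _ = ∑ _w : W, 2 * (2 ^ n * p ^ r) + F X := Finset.sum_add_distrib
      _ ≤ ∑ _w : W, 2 * (2 ^ n * p ^ r) + ∑ _w : W, e := by gcongr; exact hXF.trans hFint
      _ = Fintype.card W * (2 * (2 ^ n * p ^ r) + e) := by
          rw [← Finset.sum_add_distrib, Finset.sum_const, Finset.card_univ, nsmul_eq_mul]
      _ ≤ Fintype.card W * ENNReal.ofReal e' := by gcongr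
      _ = _ := by
          rw [ENNReal.ofReal_mul he0, ENNReal.ofReal_natCast, mul_comm]
  have hreal := ENNReal.toReal_le_of_le_ofReal (by positivity) hsum
  rw [ENNReal.toReal_sum fun w _ => measure_ne_top _ _] at hreal
  exact hreal

/-! ### Square subsystems and exponent bookkeeping -/

theorem exists_enumeration {K : ℕ} (T : Finset (Fin K)) {j : ℕ} (hT : T.card = j) :
    ∃ g : Fin j → Fin K, Function.Injective g ∧ (∀ b, g b ∈ T) ∧
      ∀ x : Fin K → ℝ, ∑ b, x (g b) = ∑ k ∈ T, x k := by
  refine ⟨T.orderEmbOfFin hT, (T.orderEmbOfFin hT).injective, T.orderEmbOfFin_mem hT,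
    fun x => ?_⟩
  have h := Finset.sum_map Finset.univ (T.orderEmbOfFin hT).toEmbedding x
  rw [show Finset.univ.map (T.orderEmbOfFin hT).toEmbedding = T by simp] at h
  exact h.symm

/-- The subset sums in the rate bounds are dominated by the level differences of a square
subsystem with users of nonnegative level. -/
theorem exists_subsystem {K N : ℕ} (S : Finset (Fin K)) (x : Fin K → ℝ) (a : Fin N → ℝ)
    (ha : (∀ m, 0 ≤ a m) ∨ ∀ k, 0 ≤ x k) (h1 : min S.card N ≤ S.card)
    (h2 : min S.card N ≤ (Finset.univ : Finset (Fin N)).card) :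
    ∃ j ≤ N, ∃ (f : Fin j → Fin N) (g : Fin j → Fin K), Function.Injective f ∧
      Function.Injective g ∧ (∀ b, g b ∈ S) ∧
      maxSubsetSum S (min S.card N) h1 (fun k => max (x k) 0) -
        minSubsetSum Finset.univ (min S.card N) h2 a ≤ ∑ b, x (g b) - ∑ i, a (f i) := by
  obtain ⟨S₂, hS₂, hmax⟩ := Finset.exists_mem_eq_sup' (Finset.powersetCard_nonempty.2 h1)
    fun t => ∑ i ∈ t, max (x i) 0
  obtain ⟨S₁, hS₁, hmin⟩ := Finset.exists_mem_eq_inf' (Finset.powersetCard_nonempty.2 h2)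
    fun t => ∑ i ∈ t, a i
  rw [maxSubsetSum, minSubsetSum, hmax, hmin]
  rw [Finset.mem_powersetCard] at hS₁ hS₂
  -- Users of negative level contribute `0` to the maximum and are dropped.
  set T := S₂.filter fun k => 0 ≤ x k with hT
  have hTS : T ⊆ S₂ := Finset.filter_subset _ _
  have hTsum : ∑ i ∈ S₂, max (x i) 0 = ∑ i ∈ T, x i := by
    rw [hT, Finset.sum_filter]
    refine Finset.sum_congr rfl fun i _ => ?_
    split_ifs with h
    · exact max_eq_left h
    · exact max_eq_right (not_le.1 h).le
  -- The noise directions must shrink to the same number. This does not raise their sum if all noise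
  -- levels are nonnegative; otherwise no user was dropped.
  obtain ⟨U, hUS, hUc, hUsum⟩ : ∃ U ⊆ S₁, U.card = T.card ∧ ∑ i ∈ U, a i ≤ ∑ i ∈ S₁, a i := by
    rcases ha with ha | ha
    · obtain ⟨U, hU, hUc⟩ := Finset.exists_subset_card_eq
        (show T.card ≤ S₁.card by rw [hS₁.2, ← hS₂.2]; exact Finset.card_le_card hTS)
      exact ⟨U, hU, hUc, Finset.sum_le_sum_of_subset_of_nonneg hU fun i _ _ => ha i⟩
    · have : T = S₂ := Finset.filter_true_of_mem fun k _ => ha k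
      exact ⟨S₁, subset_rfl, by rw [this, hS₁.2, hS₂.2], le_rfl⟩
  obtain ⟨g, hg, hgT, hgs⟩ := exists_enumeration T rfl
  obtain ⟨f, hf, -, hfs⟩ := exists_enumeration U hUc
  refine ⟨T.card, ?_, f, g, hf, hg, fun b => hS₂.1 (hTS (hgT b)), ?_⟩
  · exact (Finset.card_le_card hTS).trans (hS₂.2.trans_le (min_le_right _ _))
  · rw [hgs, hfs, hTsum]
    linarith

/-- The sum over tuples factors over users, each factor being at most `1 + M k * e k`. This treats
all difference sets at once. -/
theorem sum_prod_ite_le {K : ℕ} {M : Fin K → ℕ} (w : (k : Fin K) → Fin (M k)) (e : Fin K → ℝ)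
    (he : ∀ k, 0 ≤ e k) (hM : ∀ k, M k * e k ≤ 2) :
    ∑ w' : (k : Fin K) → Fin (M k), ∏ k, (if w k ≠ w' k then e k else 1) ≤ 3 ^ K := by
  have h := Finset.prod_univ_sum (fun k : Fin K => (Finset.univ : Finset (Fin (M k))))
    (fun k v => if w k ≠ v then e k else (1 : ℝ))
  rw [Fintype.piFinset_univ] at h
  rw [← h]
  calc _ ≤ ∏ _k : Fin K, (3 : ℝ) := by
        refine Finset.prod_le_prod (fun k _ => Finset.sum_nonneg fun v _ => ?_) fun k _ => ?_
        · split_ifs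
          · exact he k
          · exact zero_le_one
        · calc _ ≤ ∑ v : Fin (M k), ((if w k = v then 1 else 0) + e k) := by
                refine Finset.sum_le_sum fun v _ => ?_
                by_cases hv : w k = v <;> simp [hv, he k]
            _ = 1 + M k * e k := by simp [Finset.sum_add_distrib]
            _ ≤ 3 := by linarith [hM k]
    _ = 3 ^ K := by simp

/-- Of the `m ≥ (s + θ) * n` explained slots, the share `s` pays for the rate. The share `θ` makes
`4 * C` harmless, and `4` against `2 ^ n` leaves exponential decay. -/
theorem pairwise_term_le {P C s θ D : ℝ} {n m : ℕ} (hP : 1 ≤ P) (hC : 1 ≤ C)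
    (hD : 0 ≤ D) (hm : (s + θ) * n ≤ m) (hmn : m ≤ n) (hsmall : 4 * C * P ^ (-(D * θ / 2)) ≤ 1) :
    2 ^ n * (C * P ^ (-D / 2)) ^ m ≤ (1 / 2) ^ n * P ^ (-(n * s * D) / 2) := by
  have hP0 : 0 < P := by linarith
  calc 2 ^ n * (C * P ^ (-D / 2)) ^ m = 2 ^ n * (C ^ m * P ^ (-D / 2 * m)) := by
        rw [mul_pow, Real.rpow_mul_natCast hP0.le]
    _ ≤ 2 ^ n * (C ^ n * P ^ (-(D * θ / 2) * n + -(n * s * D) / 2)) := by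
        gcongr
        · nlinarith [mul_le_mul_of_nonneg_left hm hD]
    _ = (1 / 2) ^ n * (4 * C * P ^ (-(D * θ / 2))) ^ n * P ^ (-(n * s * D) / 2) := by
        rw [Real.rpow_add hP0, Real.rpow_mul_natCast hP0.le, mul_pow, mul_pow,
          show (4 : ℝ) = 2 * 2 by norm_num, mul_pow]
        have : (1 / 2 : ℝ) ^ n * 2 ^ n = 1 := by rw [← mul_pow]; norm_num
        linear_combination (-(2 ^ n * C ^ n * (P ^ (-(D * θ / 2))) ^ n *
          P ^ (-(n * s * D) / 2))) * this
    _ ≤ (1 / 2) ^ n * 1 * P ^ (-(n * s * D) / 2) := by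
        gcongr
        exact pow_le_one₀ (by positivity) hsmall
    _ = _ := by ring

/-- A bad-slot probability `4 ^ (-q)` beats the `2 ^ n` choices of slots even when only `n / q` of
them are bad; `4 ^ q` absorbs the rounding. -/
theorem outage_term_le (q n : ℕ) (hq : 0 < q) :
    (2 : ℝ) ^ n * ((1 / 4) ^ q) ^ (n / q) ≤ 4 ^ q * (1 / 2) ^ n := by
  have h1 : n ≤ q * (n / q) + q := by
    have := Nat.div_add_mod n q
    have := Nat.mod_lt n hq
    omega
  have h2 : (1 / 4 : ℝ) ^ (q * (n / q) + q) ≤ (1 / 4) ^ n :=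
    pow_le_pow_of_le_one (by norm_num) (by norm_num) h1
  have h3 : (1 / 4 : ℝ) ^ q * 4 ^ q = 1 := by rw [← mul_pow]; norm_num
  calc (2 : ℝ) ^ n * ((1 / 4) ^ q) ^ (n / q)
      = 2 ^ n * 4 ^ q * (1 / 4) ^ (q * (n / q) + q) := by
        rw [pow_add, pow_mul]
        linear_combination (-(2 ^ n * ((1 / 4 : ℝ) ^ q) ^ (n / q))) * h3
    _ ≤ 2 ^ n * 4 ^ q * (1 / 4) ^ n := by gcongr
    _ = 4 ^ q * (1 / 2) ^ n := by
        rw [show (1 / 4 : ℝ) = 1 / 2 * (1 / 2) by norm_num, mul_pow]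
        have : (2 : ℝ) ^ n * (1 / 2) ^ n = 1 := by rw [← mul_pow]; norm_num
        linear_combination (4 ^ q * (1 / 2) ^ n) * this

/-! ### Achievability of every proper fraction of the rates -/

theorem eventually_achievable {K N : ℕ} (E : Exponents K N) (ν : Measure (Coeff K N))
    [IsProbabilityMeasure ν] (hν : ∀ᵐ h ∂ν, ∃ L : ℕ, h ∈ goodSet K N L) (d : Fin K → ℝ)
    (hd : ∀ k, 0 ≤ d k)
    (hsel : ∀ S : Finset (Fin K), S.Nonempty → ∃ j ≤ N, ∃ (f : Fin j → Fin N) (g : Fin j → Fin K),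
      Function.Injective f ∧ Function.Injective g ∧ (∀ b, g b ∈ S) ∧
      ∑ k ∈ S, d k ≤ ∑ b, (E.strength (g b) - E.powerExp (g b)) - ∑ i, E.noiseLevel (f i))
    (s : ℝ) (hs0 : 0 ≤ s) (hs1 : s < 1) :
    ∀ᶠ P in atTop, Achievable E ν P fun k => s * (1 / 2 * Real.log P) * d k := by
  classical
  -- The decoder gives up `2 * (n / q)` slots; this `q` leaves a margin `θ > 0` above the fraction
  -- `s`.
  obtain ⟨q, hq⟩ := exists_nat_gt (2 / (1 - s))
  have hq' : 2 < (1 - s) * q := by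
    rw [div_lt_iff₀ (by linarith)] at hq; linarith
  have hq2 : 2 < (q : ℝ) := by nlinarith [q.cast_nonneg (α := ℝ)]
  have hqN : 2 < q := by exact_mod_cast hq2
  set θ : ℝ := 1 - s - 2 / q with hθdef
  have hθ : 0 < θ := by
    have : 2 / (q : ℝ) < 1 - s := by rw [div_lt_iff₀ (by linarith)]; exact hq'
    linarith
  set p : ENNReal := ENNReal.ofReal ((1 / 4) ^ q) with hp
  have hp0 : 0 < p := ENNReal.ofReal_pos.2 (by positivity)
  have hp1 : p ≤ 1 := ENNReal.ofReal_le_one.2 (pow_le_one₀ (by norm_num) (by norm_num))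
  -- `L` and `B` are fixed before `P`, so that `C` does not grow with `P`.
  obtain ⟨L, hL0, hL⟩ := exists_measure_compl_goodSet_le ν hν p hp0
  obtain ⟨B, hB0, hB⟩ := exists_gaussian_box N p hp0
  -- The inner `+ 1` makes the power monotone, covering all `j ≤ N`; the outer one gives `1 ≤ C`.
  set C : ℝ := L * (2 * (L * B) + 1) ^ N + 1 with hC
  have hC1 : 1 ≤ C := by rw [hC]; linarith [show 0 ≤ L * (2 * (L * B) + 1) ^ N by positivity]
  have hsmallev : ∀ᶠ P : ℝ in atTop, ∀ k, 0 < d k → 4 * C * P ^ (-(d k * θ / 2)) ≤ 1 := by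
    refine eventually_all.2 fun k => ?_
    by_cases hk : 0 < d k
    · have ht := (tendsto_rpow_neg_atTop (show 0 < d k * θ / 2 by positivity)).const_mul (4 * C)
      rw [mul_zero] at ht
      filter_upwards [ht.eventually_le_const zero_lt_one] with P hP _ using hP
    · exact Eventually.of_forall fun P h => absurd h hk
  filter_upwards [eventually_ge_atTop 1, hsmallev] with P hP1 hsmall
  have hP0 : 0 < P := by linarith
  have hlog : 0 ≤ Real.log P := Real.log_nonneg hP1
  refine ⟨fun k => mul_nonneg (by positivity) (hd k), fun ε hε => ?_⟩
  have htend : Tendsto (fun n : ℕ => (2 * 4 ^ q + 3 ^ K) * (1 / 2 : ℝ) ^ n) atTop (𝓝 0) := by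
    have := (tendsto_pow_atTop_nhds_zero_of_lt_one (r := (1 / 2 : ℝ)) (by norm_num)
      (by norm_num)).const_mul (2 * 4 ^ q + 3 ^ K)
    rwa [mul_zero] at this
  obtain ⟨n₀, hn₀⟩ := eventually_atTop.1 (htend.eventually_le_const hε)
  refine ⟨n₀, fun n hn => ?_⟩
  have hexp : ∀ k, Real.exp (n * (s * (1 / 2 * Real.log P) * d k)) = P ^ (n * s * d k / 2) :=
    fun k => by rw [Real.rpow_def_of_pos hP0]; ring_nf
  set M : Fin K → ℕ := fun k => ⌈P ^ (n * s * d k / 2)⌉₊ with hMdef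
  have hMpos : ∀ k, 0 < M k := fun k => Nat.ceil_pos.2 (Real.rpow_pos_of_pos hP0 _)
  -- Users with `d k = 0` have a single message and never differ, so distinct tuples always have a
  -- positive exponent.
  have hMone : ∀ k, d k = 0 → M k = 1 := fun k hk => by simp [hMdef, hk]
  set diff : ((k : Fin K) → Fin (M k)) → ((k : Fin K) → Fin (M k)) → Finset (Fin K) :=
    fun w w' => Finset.univ.filter fun k => w k ≠ w' k with hdiff
  have hdiffne : ∀ w w', w' ≠ w → (diff w w').Nonempty := fun w w' hne => by
    obtain ⟨k, hk⟩ := Function.ne_iff.1 hne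
    exact ⟨k, by simpa [hdiff] using fun h : w k = w' k => hk h.symm⟩
  have hdpos : ∀ w w' k, k ∈ diff w w' → 0 < d k := fun w w' k hk => by
    refine (hd k).lt_of_ne' fun h0 => (Finset.mem_filter.1 hk).2 ?_
    have := hMone k h0
    apply Fin.ext
    have h1 := (w k).isLt
    have h2 := (w' k).isLt
    omega
  have hDsmall : ∀ w w', w' ≠ w →
      4 * C * P ^ (-((∑ k ∈ diff w w', d k) * θ / 2)) ≤ 1 := fun w w' hne => by
    obtain ⟨k, hk⟩ := hdiffne w w' hne
    refine le_trans ?_ (hsmall k (hdpos w w' k hk))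
    have : d k ≤ ∑ k ∈ diff w w', d k := Finset.single_le_sum (fun i _ => hd i) hk
    gcongr
  set b : ((k : Fin K) → Fin (M k)) → ((k : Fin K) → Fin (M k)) → ENNReal := fun w w' =>
    ENNReal.ofReal (C * P ^ (-(∑ k ∈ diff w w', d k) / 2)) with hbdef
  set m := n - 2 * (n / q) with hm
  have hnq : 2 * (n / q) ≤ n := by
    have := Nat.div_mul_le_self n q
    nlinarith
  have hmn : m + 2 * (n / q) = n := by omega
  have hmreal : (s + θ) * n ≤ m := by
    have h1 : ((n / q : ℕ) : ℝ) ≤ n / q := Nat.cast_div_le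
    have h2 : (m : ℝ) + 2 * ((n / q : ℕ) : ℝ) = n := by exact_mod_cast hmn
    have h3 : (s + θ) * n = n - 2 * (n / q : ℝ) := by rw [hθdef]; ring
    linarith
  have hθ1 : θ ≤ 1 := by
    have : 0 ≤ 2 / (q : ℝ) := by positivity
    linarith
  have hDnn : ∀ w w', 0 ≤ ∑ k ∈ diff w w', d k := fun w w' => Finset.sum_nonneg fun k _ => hd k
  have hb1 : ∀ w w', w' ≠ w → b w w' ≤ 1 := fun w w' hne => by
    refine ENNReal.ofReal_le_one.2 (le_trans ?_ (hDsmall w w' hne))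
    have h1 : P ^ (-(∑ k ∈ diff w w', d k) / 2) ≤ P ^ (-((∑ k ∈ diff w w', d k) * θ / 2)) :=
      Real.rpow_le_rpow_of_exponent_le hP1 (by nlinarith [hDnn w w'])
    have h2 : 0 ≤ P ^ (-((∑ k ∈ diff w w', d k) * θ / 2)) := Real.rpow_nonneg hP0.le _
    nlinarith [mul_le_mul_of_nonneg_left h1 (show 0 ≤ C by linarith), mul_nonneg
      (show 0 ≤ C by linarith) h2]
  have hb : ∀ w w', w' ≠ w → ∀ h z, unitCube ((k : Fin K) × Fin (M k)) {x | (h, received E P h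
      (fun k => scaled E P (symbols x w) k - scaled E P (symbols x w') k) z) ∈
        slotSet E P L B} ≤ b w w' := fun w w' hne h z => by
    obtain ⟨j, hj, f, g, hf, hg, hgS, hle⟩ := hsel _ (hdiffne w w' hne)
    refine (slot_probability_le E hP0 hL0 hB0 hj f g hf hg w w'
      (fun b => (Finset.mem_filter.1 (hgS b)).2) h z).trans (ENNReal.ofReal_le_ofReal ?_)
    have hC' : L * (2 * (L * B)) ^ j ≤ C := by
      calc L * (2 * (L * B)) ^ j ≤ L * (2 * (L * B) + 1) ^ j := by gcongr; linarith
        _ ≤ L * (2 * (L * B) + 1) ^ N := by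
          gcongr
          linarith [show 0 ≤ 2 * (L * B) by positivity]
        _ ≤ C := by rw [hC]; linarith
    gcongr
    linarith
  set e : Fin K → ℝ := fun k => P ^ (-(n * s * d k) / 2) with hedef
  have he0 : ∀ k, 0 ≤ e k := fun k => Real.rpow_nonneg hP0.le _
  have hMe : ∀ k, M k * e k ≤ 2 := fun k => by
    have h1 : (M k : ℝ) ≤ P ^ (n * s * d k / 2) + 1 :=
      (Nat.ceil_lt_add_one (Real.rpow_nonneg hP0.le _)).le
    have h2 : P ^ (n * s * d k / 2) * e k = 1 := by
      rw [hedef, ← Real.rpow_add hP0]; ring_nf; exact Real.rpow_zero P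
    have h3 : e k ≤ 1 := Real.rpow_le_one_of_one_le_of_nonpos hP1 (by
      have := hd k
      have : 0 ≤ n * s * d k := by positivity
      linarith)
    nlinarith [mul_le_mul_of_nonneg_right h1 (he0 k)]
  have he : ∀ w, ∑ w' ∈ Finset.univ.erase w, 2 ^ n * b w w' ^ m ≤
      ENNReal.ofReal (3 ^ K * (1 / 2) ^ n) := fun w => by
    have hterm : ∀ w' ∈ Finset.univ.erase w, 2 ^ n * b w w' ^ m ≤
        ENNReal.ofReal ((1 / 2) ^ n * ∏ k, (if w k ≠ w' k then e k else 1)) := fun w' hw' => by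
      have hne := Finset.ne_of_mem_erase hw'
      have hprod : ∏ k, (if w k ≠ w' k then e k else 1) =
          P ^ (-(n * s * ∑ k ∈ diff w w', d k) / 2) := by
        rw [← Finset.prod_filter, prod_rpow_half hP0, Finset.sum_neg_distrib, ← Finset.mul_sum]
      rw [hprod, hbdef, ← ENNReal.ofReal_pow (by positivity),
        show (2 : ENNReal) = ENNReal.ofReal 2 by simp, ← ENNReal.ofReal_pow (by norm_num),
        ← ENNReal.ofReal_mul (by positivity)]
      exact ENNReal.ofReal_le_ofReal (pairwise_term_le hP1 hC1 (hDnn w w') hmreal (by omega)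
        (hDsmall w w' hne))
    have hnn : ∀ w' : (k : Fin K) → Fin (M k),
        0 ≤ (1 / 2 : ℝ) ^ n * ∏ k, (if w k ≠ w' k then e k else 1) := fun w' =>
      mul_nonneg (by positivity) (Finset.prod_nonneg fun k _ => by
        split_ifs
        · exact he0 k
        · exact zero_le_one)
    refine (Finset.sum_le_sum hterm).trans ?_
    rw [← ENNReal.ofReal_sum_of_nonneg fun w' _ => hnn w']
    refine ENNReal.ofReal_le_ofReal ?_
    calc _ ≤ ∑ w' : (k : Fin K) → Fin (M k),
          (1 / 2 : ℝ) ^ n * ∏ k, (if w k ≠ w' k then e k else 1) :=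
          Finset.sum_le_sum_of_subset_of_nonneg (Finset.erase_subset _ _) fun w' _ _ => hnn w'
      _ = (1 / 2 : ℝ) ^ n * ∑ w' : (k : Fin K) → Fin (M k),
          ∏ k, (if w k ≠ w' k then e k else 1) := by rw [Finset.mul_sum]
      _ ≤ (1 / 2 : ℝ) ^ n * 3 ^ K := by
          gcongr
          exact sum_prod_ite_le w e he0 hMe
      _ = _ := mul_comm _ _
  obtain ⟨c, hc1, hc2⟩ := exists_code_avgError_le hMpos E hP0 ν L B m (n / q) hmn.le p hp1 hL hB b
    hb1 hb _ he ε hε.le (by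
      rw [hp, ← ENNReal.ofReal_pow (by positivity),
        show (2 : ENNReal) = ENNReal.ofReal 2 by simp, ← ENNReal.ofReal_pow (by norm_num),
        ← ENNReal.ofReal_mul (by positivity), ← ENNReal.ofReal_mul (by positivity),
        ← ENNReal.ofReal_add (by positivity) (by positivity)]
      refine ENNReal.ofReal_le_ofReal (le_trans ?_ (hn₀ n hn))
      have := outage_term_le q n (by omega)
      linarith)
  refine ⟨M, c, fun k => ?_, hc1, hc2⟩
  rw [hexp]
  exact Nat.le_ceil _

/-! ### From rates to degrees of freedom -/

theorem achievable_zero {K N : ℕ} (E : Exponents K N) (ν : Measure (Coeff K N)) {P : ℝ}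
    (hP : 0 < P) : Achievable E ν P 0 := by
  refine ⟨fun _ => le_rfl, fun ε hε => ⟨0, fun n _ => ⟨fun _ => 1,
    ⟨fun _ _ _ => 0, fun _ _ => 0, measurable_const⟩, by simp, fun k w => ?_, ?_⟩⟩⟩
  · have := Real.rpow_nonneg hP.le (-E.powerExp k)
    simp only [ne_eq, OfNat.ofNat_ne_zero, not_false_eq_true, zero_pow, Finset.sum_const_zero]
    positivity
  · have : ∀ w, Code.errorEvent (M := fun _ : Fin K => 1)
        (⟨fun _ _ _ => 0, fun _ _ => 0, measurable_const⟩ : Code K N n fun _ => 1) E P w = ∅ := by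
      intro w
      ext x
      simp only [Code.errorEvent, Set.mem_ofPred_eq, Set.mem_empty_iff_false, iff_false, not_not]
      exact Subsingleton.elim _ _
    simp only [Code.avgError, this]
    simpa using hε.le

/-- Degrees of freedom all of whose proper multiples are eventually achievable lie in the GDoF
region. -/
theorem mem_gdofRegion {K N : ℕ} (E : Exponents K N) (ν : Measure (Coeff K N)) (d : Fin K → ℝ)
    (h : ∀ s : ℝ, 0 ≤ s → s < 1 →
      ∀ᶠ P in atTop, Achievable E ν P fun k => s * (1 / 2 * Real.log P) * d k) :
    d ∈ gdofRegion E ν := by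
  -- The largest fraction `s` available at each `P` gives a single rate function. The supremum is
  -- attained because the capacity region is closed, and it tends to `1`; `s = 0` serves for small
  -- `P`.
  let T : ℝ → Set ℝ := fun P => Set.Icc 0 1 ∩
    (fun s k => s * (1 / 2 * Real.log P) * d k) ⁻¹' capacityRegion E ν P
  have hcont : ∀ P, Continuous fun (s : ℝ) (k : Fin K) => s * (1 / 2 * Real.log P) * d k :=
    fun P => by fun_prop
  have hcomp : ∀ P, IsCompact (T P) := fun P =>
    isCompact_Icc.inter_right (isClosed_closure.preimage (hcont P))
  have hne : ∀ P > 0, (T P).Nonempty := fun P hP => ⟨0, by simp, by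
    have h0 : (fun k : Fin K => (0 : ℝ) * (1 / 2 * Real.log P) * d k) = 0 := by
      ext k; simp
    rw [Set.mem_preimage, h0]
    exact subset_closure (achievable_zero E ν hP)⟩
  have hmem : ∀ P > 0, sSup (T P) ∈ T P := fun P hP => (hcomp P).sSup_mem (hne P hP)
  refine ⟨fun P k => sSup (T P) * (1 / 2 * Real.log P) * d k, fun P hP => (hmem P hP).2,
    fun k => ?_⟩
  have hlim : Tendsto (fun P => sSup (T P)) atTop (𝓝 1) := by
    refine tendsto_order.2 ⟨fun a ha => ?_, fun a ha => ?_⟩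
    · obtain ⟨s, hs, hs1⟩ := exists_between (max_lt ha zero_lt_one)
      have hs0 : 0 ≤ s := (le_max_right _ _).trans hs.le
      filter_upwards [h s hs0 hs1] with P hP
      refine ((le_max_left _ _).trans_lt hs).trans_le (le_csSup (hcomp P).bddAbove ?_)
      exact ⟨⟨hs0, hs1.le⟩, subset_closure hP⟩
    · filter_upwards [eventually_gt_atTop 0] with P hP
      exact (hmem P hP).1.2.trans_lt ha
  have hlim' := hlim.mul_const (d k)
  rw [one_mul] at hlim'
  refine hlim'.congr' ?_
  filter_upwards [eventually_gt_atTop 1] with P hP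
  have : Real.log P ≠ 0 := (Real.log_pos hP).ne'
  field_simp

end MAC

end

theorem lemma2 (M₁ M₂ N : ℕ) (α : ℝ) (η : Fin (M₁ + M₂) → ℝ) (a : Fin N → ℝ)
    (hη : ∀ k, 0 ≤ η k)
    (ha : (∀ m, 0 ≤ a m) ∨ ∀ k, η k ≤ MAC.userStrength M₁ M₂ α k)
    (ν : Measure (MAC.Coeff (M₁ + M₂) N)) [IsProbabilityMeasure ν]
    (hν : MAC.HasBoundedDensity ν)
    (d : Fin (M₁ + M₂) → ℝ) (hd : ∀ k, 0 ≤ d k)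
    (hsum : ∀ S : Finset (Fin (M₁ + M₂)), S.Nonempty →
      ∑ i ∈ S, d i ≤
        MAC.maxSubsetSum S (min S.card N) (min_le_left _ _) (MAC.gammaLevel M₁ M₂ α η) -
        MAC.minSubsetSum (Finset.univ : Finset (Fin N)) (min S.card N) (by simp) a) :
    d ∈ MAC.gdofRegion ⟨MAC.userStrength M₁ M₂ α, η, a⟩ ν ∧
      ∀ᵐ h ∂ν, d ∈ MAC.gdofRegion ⟨MAC.userStrength M₁ M₂ α, η, a⟩ (Measure.dirac h) := by
  have hsel : ∀ S : Finset (Fin (M₁ + M₂)), S.Nonempty → ∃ j ≤ N, ∃ (f : Fin j → Fin N)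
      (g : Fin j → Fin (M₁ + M₂)), Function.Injective f ∧ Function.Injective g ∧
      (∀ b, g b ∈ S) ∧ ∑ k ∈ S, d k ≤
        ∑ b, (MAC.userStrength M₁ M₂ α (g b) - η (g b)) - ∑ i, a (f i) := by
    intro S hS
    obtain ⟨j, hj, f, g, hf, hg, hgS, hle⟩ := MAC.exists_subsystem S
      (fun k => MAC.userStrength M₁ M₂ α k - η k) a (ha.imp_right fun h k => sub_nonneg.2 (h k))
      (min_le_left _ _) (by simp)
    exact ⟨j, hj, f, g, hf, hg, hgS, (hsum S hS).trans hle⟩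
  have hgood : ∀ᵐ h ∂ν, ∃ L : ℕ, h ∈ MAC.goodSet (M₁ + M₂) N L := by
    obtain ⟨f, C, -, -, rfl⟩ := hν
    exact (withDensity_absolutelyContinuous _ _).ae_le (MAC.ae_exists_mem_goodSet _ _)
  refine ⟨MAC.mem_gdofRegion _ _ d fun s hs0 hs1 =>
    MAC.eventually_achievable _ ν hgood d hd hsel s hs0 hs1, ?_⟩
  filter_upwards [hgood] with h hh
  -- A Dirac law at a point in general position satisfies the same almost sure condition, so the
  -- i.i.d. argument applies verbatim.
  refine MAC.mem_gdofRegion _ _ d fun s hs0 hs1 =>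
    MAC.eventually_achievable _ (Measure.dirac h) ?_ d hd hsel s hs0 hs1
  have hmeas : MeasurableSet {h : MAC.Coeff (M₁ + M₂) N | ∃ L : ℕ, h ∈ MAC.goodSet _ N L} := by
    have : {h : MAC.Coeff (M₁ + M₂) N | ∃ L : ℕ, h ∈ MAC.goodSet _ N L} =
        ⋃ L : ℕ, MAC.goodSet (M₁ + M₂) N L := by ext; simp
    rw [this]
    exact MeasurableSet.iUnion fun L => MAC.measurableSet_goodSet _ _ _
  exact (ae_dirac_iff hmeas).2 hh
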